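/- Let $c>1$ and let $\mathcal E_c\subset\mathbb C$ be the interior of the ellipse with foci $\pm1$ and sum of semi-axes $c$, i.e. $\mathcal E_c=\{x+iy : x^2/a^2+y^2/b^2<1\}$ with $a=\frac{c^2+1}{2c}$, $b=\frac{c^2-1}{2c}$. For a domain $D\subsetneq\mathbb C$ with $[-1,1]\subset D$ put $\delta_D=\sup_{x\in[-1,1]}\inf\{|x-z| : z\in\mathbb C\setminus D\}$. For nodes $-1\le x_1<\dots<x_n\le 1$ and positive integers $k_1,\dots,k_n$ let $\mathcal F_+(D;(x_j);(k_j))$ be the set of holomorphic functions $f$ from $D$ to the open unit disc such that $f^{(l)}(x_j)=0$ for $0\le l\le k_j-1$, $1\le j\le n$, and such that $f$ is real and nonnegative on $D\cap\mathbb R$. Let $$J_+(D;(x_j);(k_j))=\sup\Bigl\{\Bigl|\int_{-1}^1 f(x)\,dx\Bigr| : f\in\mathcal F_+(D;(x_j);(k_j))\Bigr\},$$ and for a positive integer $N$ let $J_+(D;N)$ be the infimum of $J_+(D;(x_j);(k_j))$ over all $n$, all nodes $-1\le x_1<\dots<x_n\le1$ and all positive integers $k_1,\dots,k_n$ with $k_1+\dots+k_n=N$.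 Then $\delta_{\mathcal E_c}=\frac{c^2-1}{2c}$, and for every positive integer $N$ $$J_+(\mathcal E_c;N)\ \ge\ 2\left(\left(\frac{c^2-1+c}{c^2-1}\right)^{(c^2-1)/c}\left(\frac{c^2-1+c}{c}\right)\right)^{-2N}.$$ -/

import Mathlib

open Set MeasureTheory

noncomputable section

namespace EllipseQuadrature

/-- The open region bounded by the ellipse with centre `0`, horizontal semi-axis `a` and
vertical semi-axis `b`. -/
def ellipseInterior (a b : ℝ) : Set ℂ :=
  {z : ℂ | z.re ^ 2 / a ^ 2 + z.im ^ 2 / b ^ 2 < 1}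

/-- The horizontal semi-axis of the ellipse with foci `±1` and sum of semi-axes `c`. -/
def semiMajor (c : ℝ) : ℝ := (c ^ 2 + 1) / (2 * c)

/-- The vertical semi-axis of the ellipse with foci `±1` and sum of semi-axes `c`. -/
def semiMinor (c : ℝ) : ℝ := (c ^ 2 - 1) / (2 * c)

/-- `𝓔_c`: the interior of the ellipse with foci `±1` and sum of semi-axes `c`. -/
def ellipse (c : ℝ) : Set ℂ := ellipseInterior (semiMajor c) (semiMinor c)

/-- For `c > 1`, the two numbers above are the only positive `a`, `b` with `a ^ 2 - b ^ 2 = 1`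
(that is, with foci `±1`) and `a + b = c`. -/
theorem semiAxes_iff {c : ℝ} (hc : 1 < c) (a b : ℝ) :
    (0 < a ∧ 0 < b ∧ a ^ 2 - b ^ 2 = 1 ∧ a + b = c) ↔ (a = semiMajor c ∧ b = semiMinor c) := by
  have hc0 : 0 < c := by linarith
  unfold semiMajor semiMinor
  constructor
  · rintro ⟨_, _, h1, h2⟩
    subst h2
    constructor
    · rw [eq_div_iff (by positivity)]
      linear_combination h1
    · rw [eq_div_iff (by positivity)]
      linear_combination -h1
  · rintro ⟨rfl, rfl⟩
    refine ⟨by positivity, ?_, ?_, ?_⟩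
    · have : 0 < c ^ 2 - 1 := by nlinarith
      positivity
    · field_simp
      ring
    · field_simp
      ring

/-- `δ_D(x) = inf {|x - z| : z ∉ D}`. -/
def boundaryDist (D : Set ℂ) (x : ℂ) : ℝ := sInf {r : ℝ | ∃ z : ℂ, z ∉ D ∧ r = ‖x - z‖}

/-- `δ_D = sup {δ_D(x) : x ∈ [-1, 1]}`. -/
def inradius (D : Set ℂ) : ℝ :=
  sSup {r : ℝ | ∃ x : ℝ, x ∈ Icc (-1 : ℝ) 1 ∧ r = boundaryDist D (x : ℂ)}

/-- `𝓕(D; X; 𝓚)`: the holomorphic functions from `D` to the open unit disc that vanish at each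
node `x j` together with their derivatives of order less than `k j`. Functions on `D` are
represented by functions on `ℂ`, of which only the values on the open set `D` matter. -/
def admissible (D : Set ℂ) {n : ℕ} (x : Fin n → ℝ) (k : Fin n → ℕ) : Set (ℂ → ℂ) :=
  {f | DifferentiableOn ℂ f D ∧ (∀ z ∈ D, ‖f z‖ < 1) ∧
    ∀ j : Fin n, ∀ l : ℕ, l < k j → iteratedDeriv l f (x j : ℂ) = 0}

/-- `𝓕_r(D; X; 𝓚)`: the members of `𝓕(D; X; 𝓚)` that are real on `D ∩ ℝ`. -/
def admissibleReal (D : Set ℂ) {n : ℕ} (x : Fin n → ℝ) (k : Fin n → ℕ) : Set (ℂ → ℂ) :=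
  {f | f ∈ admissible D x k ∧ ∀ t : ℝ, (t : ℂ) ∈ D → (f (t : ℂ)).im = 0}

/-- `𝓕_+(D; X; 𝓚)`: the members of `𝓕_r(D; X; 𝓚)` that are nonnegative on `D ∩ ℝ`. -/
def admissibleNonneg (D : Set ℂ) {n : ℕ} (x : Fin n → ℝ) (k : Fin n → ℕ) : Set (ℂ → ℂ) :=
  {f | f ∈ admissibleReal D x k ∧ ∀ t : ℝ, (t : ℂ) ∈ D → 0 ≤ (f (t : ℂ)).re}

/-- `J_+(D; X; 𝓚)` with respect to the measure `α`: the supremum of `|∫_{-1}^1 f dα|` over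
`f ∈ 𝓕_+(D; X; 𝓚)`. -/
def JPlusNodes (D : Set ℂ) (α : Measure ℝ) {n : ℕ} (x : Fin n → ℝ) (k : Fin n → ℕ) : ℝ :=
  sSup {r : ℝ | ∃ f ∈ admissibleNonneg D x k, r = ‖∫ t in Icc (-1 : ℝ) 1, f (t : ℂ) ∂α‖}

/-- `J_+(D; N)` with respect to the measure `α`: the infimum of `J_+(D; X; 𝓚)` over all nodes
`-1 ≤ x_1 < … < x_n ≤ 1` and all positive multiplicities with `k_1 + … + k_n = N`. -/
def JPlus (D : Set ℂ) (α : Measure ℝ) (N : ℕ) : ℝ :=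
  sInf {r : ℝ | ∃ (n : ℕ) (x : Fin n → ℝ) (k : Fin n → ℕ),
    StrictMono x ∧ (∀ j, x j ∈ Icc (-1 : ℝ) 1) ∧ (∀ j, 0 < k j) ∧ ∑ j, k j = N ∧
    r = JPlusNodes D α x k}

end EllipseQuadrature

end

/-! The ellipse lies in the strip |Im z| < d, with d its vertical semi-axis, so functions on the
strip compete. A product of strip maps raised to the powers 2k_j vanishes to the required orders and
is nonnegative on the real axis; it remains to bound its integral below, uniformly in the nodes. On
the axis each strip map is a tanh, of modulus at least |t - a| / (|t - a| + s) with s = 2d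
(`le_abs_stripMap_ofReal`). Jensen's inequality for exp (`two_mul_exp_le_integral`) reduces the
integral of the product to a sum of integrals of logarithms, and the lower bound for each is its
value for a node at 0 (`le_integral_potential`). Only the total multiplicity N survives, and s = (c²
- 1)/c gives the stated constant. -/

namespace EllipseQuadrature

/-! ### Conformal maps of the strip -/

/-- The conformal map of the strip `|Im z| < d` onto the unit disc that sends the real point `a`
to `0` and the real axis into itself. -/
noncomputable def stripMap (d a : ℝ) (z : ℂ) : ℂ :=
  (Complex.exp ((Real.pi / (2 * d) : ℝ) * (z - a)) - 1) /
    (Complex.exp ((Real.pi / (2 * d) : ℝ) * (z - a)) + 1)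

theorem exp_strip_re_pos {d : ℝ} (a : ℝ) {z : ℂ} (hz : |z.im| < d) :
    0 < (Complex.exp ((Real.pi / (2 * d) : ℝ) * (z - a))).re := by
  have hd : 0 < d := (abs_nonneg _).trans_lt hz
  rw [Complex.exp_re]
  refine mul_pos (Real.exp_pos _) (Real.cos_pos_of_mem_Ioo ?_)
  have him : ((Real.pi / (2 * d) : ℝ) * (z - a)).im = Real.pi / 2 * (z.im / d) := by
    rw [Complex.im_ofReal_mul, Complex.sub_im, Complex.ofReal_im]
    field_simp
    ring
  rw [him]
  obtain ⟨h1, h2⟩ := abs_lt.1 hz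
  have h3 : z.im / d < 1 := (div_lt_one hd).2 h2
  have h4 : -1 < z.im / d := by
    rw [lt_div_iff₀ hd]
    linarith
  have := Real.pi_pos
  constructor <;> nlinarith

/-- This is |w + 1|² - |w - 1|² = 4 Re w. -/
theorem norm_sub_one_div_add_one_lt_one {w : ℂ} (hw : 0 < w.re) : ‖(w - 1) / (w + 1)‖ < 1 := by
  have h1 : w + 1 ≠ 0 := fun h ↦ by
    have := congrArg Complex.re h
    simp at this
    linarith
  rw [norm_div, div_lt_one (norm_pos_iff.2 h1)]
  rw [← sq_lt_sq₀ (norm_nonneg _) (norm_nonneg _), ← Complex.normSq_eq_norm_sq,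
    ← Complex.normSq_eq_norm_sq, Complex.normSq_apply, Complex.normSq_apply]
  simp
  nlinarith

theorem norm_stripMap_lt_one {d : ℝ} (a : ℝ) {z : ℂ} (hz : |z.im| < d) :
    ‖stripMap d a z‖ < 1 :=
  norm_sub_one_div_add_one_lt_one (exp_strip_re_pos a hz)

theorem differentiableAt_stripMap {d : ℝ} (a : ℝ) {z : ℂ} (hz : |z.im| < d) :
    DifferentiableAt ℂ (stripMap d a) z := by
  have h1 : Complex.exp ((Real.pi / (2 * d) : ℝ) * (z - a)) + 1 ≠ 0 := fun h ↦ by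
    have h0 := exp_strip_re_pos a hz
    have := congrArg Complex.re h
    rw [Complex.add_re, Complex.one_re, Complex.zero_re] at this
    linarith
  unfold stripMap
  exact DifferentiableAt.div (by fun_prop) (by fun_prop) h1

theorem stripMap_self (d a : ℝ) : stripMap d a a = 0 := by simp [stripMap]

theorem stripMap_ofReal (d a t : ℝ) :
    stripMap d a t = (((Real.exp (Real.pi / (2 * d) * (t - a)) - 1) /
      (Real.exp (Real.pi / (2 * d) * (t - a)) + 1) : ℝ) : ℂ) := by
  simp [stripMap]

/-- The quotient is odd in y, and for y ≥ 0 it increases with exp y ≥ 1 + y. -/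
theorem div_add_one_le_abs_exp (y : ℝ) :
    |y| / (|y| + 2) ≤ |(Real.exp y - 1) / (Real.exp y + 1)| := by
  wlog hy : 0 ≤ y generalizing y with H
  · have := H (-y) (by linarith)
    rw [abs_neg] at this
    refine this.trans_eq ?_
    rw [← abs_neg]
    congr 1
    rw [Real.exp_neg]
    have := Real.exp_pos y
    field_simp
    ring
  · have h1 := Real.add_one_le_exp y
    rw [abs_of_nonneg hy, abs_of_nonneg (div_nonneg (by linarith) (by linarith)),
      div_le_div_iff₀ (by linarith) (by linarith)]
    nlinarith

/-- Rescaling the previous bound gives 4d/π in place of 2d, so π ≥ 2 suffices. -/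
theorem le_abs_stripMap_ofReal {d : ℝ} (hd : 0 < d) (a t : ℝ) :
    |t - a| / (|t - a| + 2 * d) ≤ ‖stripMap d a t‖ := by
  rw [stripMap_ofReal, Complex.norm_real, Real.norm_eq_abs]
  refine le_trans ?_ (div_add_one_le_abs_exp _)
  have hpi := Real.pi_gt_three
  rw [abs_mul, abs_of_pos (by positivity : 0 < Real.pi / (2 * d))]
  have h0 := abs_nonneg (t - a)
  rw [div_le_div_iff₀ (by positivity) (by positivity)]
  have h : Real.pi / (2 * d) * |t - a| * (2 * d) = Real.pi * |t - a| := by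
    field_simp
  nlinarith

theorem iteratedDeriv_pow_mul_eq_zero {g h : ℂ → ℂ} {z : ℂ} {m l : ℕ} (hg : AnalyticAt ℂ g z)
    (hh : AnalyticAt ℂ h z) (hz : g z = 0) (hl : l < m) :
    iteratedDeriv l (fun w ↦ g w ^ m * h w) z = 0 := by
  have ha : AnalyticAt ℂ (fun w ↦ g w ^ m * h w) z := (hg.pow m).mul hh
  have h1 : (m : ℕ∞) ≤ analyticOrderAt (fun w ↦ g w ^ m * h w) z := by
    change (m : ℕ∞) ≤ analyticOrderAt (g ^ m * h) z
    rw [analyticOrderAt_mul (hg.pow m) hh, analyticOrderAt_pow hg]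
    have h2 : 1 ≤ analyticOrderAt g z := by
      rw [Order.one_le_iff_ne_zero]
      exact fun h0 ↦ (hg.analyticOrderAt_eq_zero.1 h0) hz
    calc (m : ℕ∞) = m • 1 := by simp
      _ ≤ m • analyticOrderAt g z := nsmul_le_nsmul_right h2 m
      _ ≤ _ := le_self_add
  exact (natCast_le_analyticOrderAt_iff_iteratedDeriv_eq_zero ha).1 h1 l hl

/-! ### Integrals of logarithmic potentials -/

/-- The log sum inequality for the pairs `(u, 1)` and `(s, s)`. -/
theorem add_mul_log_le {s u : ℝ} (hs : 0 < s) (hu : 0 ≤ u) :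
    (u + s) * Real.log (u + s) - u * Real.log u ≤ (u + s) * Real.log (1 + s) := by
  have hy : 0 < (u + s) / (1 + s) := by positivity
  have hlog : Real.log ((u + s) / (1 + s)) = Real.log (u + s) - Real.log (1 + s) :=
    Real.log_div (by positivity) (by positivity)
  have h1 := Real.log_le_sub_one_of_pos hy
  have hy' : (u + s) / (1 + s) * (1 + s) = u + s := by field_simp
  set y := (u + s) / (1 + s)
  -- The bound log r ≤ r - 1 is used at y with weight s and at y/u with weight u; the right sides
  -- cancel, since s(y - 1) + (y - u) = 0.
  have h2 : s * Real.log y ≤ s * (y - 1) := mul_le_mul_of_nonneg_left h1 hs.le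
  rcases hu.eq_or_lt with rfl | hu
  · nlinarith
  · have h3 := Real.log_le_sub_one_of_pos (div_pos hy hu)
    rw [Real.log_div hy.ne' hu.ne'] at h3
    have h4 := mul_le_mul_of_nonneg_left h3 hu.le
    have h5 : u * (y / u - 1) = y - u := by field_simp
    nlinarith

theorem intervalIntegrable_log_abs_add {s : ℝ} (hs : 0 < s) (p q : ℝ) :
    IntervalIntegrable (fun t : ℝ ↦ Real.log (|t| + s)) volume p q := by
  refine Continuous.intervalIntegrable ?_ _ _
  exact Continuous.log (by fun_prop) fun t ↦ by positivity

theorem integral_log_abs_add {s u : ℝ} (hu : 0 ≤ u) :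
    ∫ t in (0 : ℝ)..u, Real.log (|t| + s) =
      (u + s) * Real.log (u + s) - s * Real.log s - u := by
  have h : ∫ t in (0 : ℝ)..u, Real.log (|t| + s) = ∫ t in (0 : ℝ)..u, Real.log (t + s) := by
    refine intervalIntegral.integral_congr fun t ht ↦ ?_
    rw [uIcc_of_le hu] at ht
    simp only [abs_of_nonneg ht.1]
  rw [h, intervalIntegral.integral_comp_add_right (fun t ↦ Real.log t), integral_log, zero_add]
  ring

/-- The potential `log (|t - a| / (|t - a| + s))` for `t ≠ a`. -/
noncomputable def potential (s a t : ℝ) : ℝ := Real.log (t - a) - Real.log (|t - a| + s)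

theorem intervalIntegrable_potential {s : ℝ} (hs : 0 < s) (a p q : ℝ) :
    IntervalIntegrable (potential s a) volume p q := by
  have h : IntervalIntegrable (fun t : ℝ ↦ Real.log t - Real.log (|t| + s)) volume
      (p - a) (q - a) :=
    intervalIntegral.intervalIntegrable_log'.sub (intervalIntegrable_log_abs_add hs _ _)
  unfold potential
  simpa using h.comp_sub_right a

/-- The integral is the sum over u = 1 - a and u = 1 + a of u log u - (u + s) log(u + s) + s log s.
The log sum bound is affine in u, so a drops out of the total; equality holds at a = 0. -/
theorem le_integral_potential {s a : ℝ} (hs : 0 < s) (ha : a ∈ Icc (-1 : ℝ) 1) :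
    -2 * ((1 + s) * Real.log (1 + s) - s * Real.log s) ≤
      ∫ t in (-1 : ℝ)..1, potential s a t := by
  have h1 : ∫ t in (-1 : ℝ)..1, potential s a t =
      ∫ t in (-1 - a)..(1 - a), (Real.log t - Real.log (|t| + s)) :=
    intervalIntegral.integral_comp_sub_right (fun t ↦ Real.log t - Real.log (|t| + s)) a
  have h2 : ∫ t in (-1 - a)..0, Real.log (|t| + s) = ∫ t in 0..(1 + a), Real.log (|t| + s) := by
    have := intervalIntegral.integral_comp_neg (a := 0) (b := 1 + a)
      (fun t : ℝ ↦ Real.log (|t| + s))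
    simp only [abs_neg, neg_zero] at this
    rw [this]
    congr 1
    ring
  have h3 := intervalIntegral.integral_add_adjacent_intervals
    (intervalIntegrable_log_abs_add hs (-1 - a) 0) (intervalIntegrable_log_abs_add hs 0 (1 - a))
  have ha1 : 0 ≤ 1 - a := by linarith [ha.2]
  have ha2 : 0 ≤ 1 + a := by linarith [ha.1]
  have h4 : Real.log (-1 - a) = Real.log (1 + a) := by
    rw [← Real.log_neg_eq_log]
    congr 1
    ring
  rw [h1, intervalIntegral.integral_sub intervalIntegral.intervalIntegrable_log'
    (intervalIntegrable_log_abs_add hs _ _), ← h3, h2, integral_log,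
    integral_log_abs_add ha1, integral_log_abs_add ha2, h4]
  have h5 := add_mul_log_le hs ha1
  have h6 := add_mul_log_le hs ha2
  linarith

theorem exp_potential {s a t : ℝ} (hs : 0 < s) (h : t ≠ a) :
    Real.exp (potential s a t) = |t - a| / (|t - a| + s) := by
  have h0 : 0 < |t - a| := abs_pos.2 (sub_ne_zero.2 h)
  rw [potential, Real.exp_sub, ← Real.log_abs, Real.exp_log h0, Real.exp_log (by positivity)]

/-- Jensen's inequality for the exponential function on `[-1, 1]`. -/
theorem two_mul_exp_le_integral {F h : ℝ → ℝ} {m : ℝ} (hF : IntervalIntegrable F volume (-1) 1)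
    (hh : IntervalIntegrable h volume (-1) 1) (hm : 2 * m ≤ ∫ t in (-1 : ℝ)..1, h t)
    (hle : ∀ᵐ t : ℝ, t ∈ Icc (-1 : ℝ) 1 → Real.exp (h t) ≤ F t) :
    2 * Real.exp m ≤ ∫ t in (-1 : ℝ)..1, F t := by
  have hc : IntervalIntegrable (fun _ : ℝ ↦ 1 - m) volume (-1) 1 := intervalIntegrable_const
  -- F dominates the tangent line of exp at m, evaluated at h; integrability of exp ∘ h is not
  -- needed.
  have h1 : ∫ t in (-1 : ℝ)..1, Real.exp m * (h t + (1 - m)) ≤ ∫ t in (-1 : ℝ)..1, F t := by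
    refine intervalIntegral.integral_mono_ae_restrict (by norm_num) ((hh.add hc).const_mul _) hF ?_
    refine (ae_restrict_iff' measurableSet_Icc).2 ?_
    filter_upwards [hle] with t ht hmem
    refine le_trans ?_ (ht hmem)
    have h2 : Real.exp (h t) = Real.exp m * Real.exp (h t - m) := by
      rw [← Real.exp_add]
      congr 1
      ring
    rw [h2]
    exact mul_le_mul_of_nonneg_left (by linarith [Real.add_one_le_exp (h t - m)])
      (Real.exp_pos m).le
  refine le_trans ?_ h1
  rw [intervalIntegral.integral_const_mul, intervalIntegral.integral_add hh hc,
    intervalIntegral.integral_const, smul_eq_mul]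
  nlinarith [Real.exp_pos m]

/-! ### The extremal candidate -/

/-- The square of the finite product of strip maps vanishing at the points `x j` to the
orders `k j`. -/
noncomputable def stripProduct (d : ℝ) {n : ℕ} (x : Fin n → ℝ) (k : Fin n → ℕ) (z : ℂ) : ℂ :=
  ∏ j, stripMap d (x j) z ^ (2 * k j)

section stripProduct

variable {d : ℝ} {n : ℕ} (x : Fin n → ℝ) (k : Fin n → ℕ)

theorem stripProduct_ofReal (t : ℝ) :
    stripProduct d x k t = ((∏ j, ‖stripMap d (x j) t‖ ^ (2 * k j) : ℝ) : ℂ) := by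
  rw [stripProduct, Complex.ofReal_prod]
  refine Finset.prod_congr rfl fun j _ ↦ ?_
  rw [stripMap_ofReal, Complex.norm_real, Real.norm_eq_abs, pow_mul, pow_mul,
    ← Complex.ofReal_pow, sq_abs, Complex.ofReal_pow, Complex.ofReal_pow,
    Complex.ofReal_pow]

theorem differentiableAt_stripProduct {z : ℂ} (hz : |z.im| < d) :
    DifferentiableAt ℂ (stripProduct d x k) z := by
  unfold stripProduct
  exact DifferentiableAt.fun_finsetProd fun j _ ↦ (differentiableAt_stripMap (x j) hz).pow _

theorem analyticAt_of_strip {f : ℂ → ℂ} (hf : ∀ z : ℂ, |z.im| < d → DifferentiableAt ℂ f z)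
    {z : ℂ} (hz : |z.im| < d) : AnalyticAt ℂ f z := by
  refine DifferentiableOn.analyticAt (s := {z : ℂ | |z.im| < d})
    (fun w hw ↦ (hf w hw).differentiableWithinAt) ?_
  exact (isOpen_lt (by fun_prop) continuous_const).mem_nhds hz

theorem stripProduct_mem_admissibleNonneg {D : Set ℂ} (hd : 0 < d)
    (hD : ∀ z ∈ D, |z.im| < d) (hk : ∀ j, 0 < k j) (hn : 0 < n) :
    stripProduct d x k ∈ admissibleNonneg D x k := by
  refine ⟨⟨⟨fun z hz ↦ (differentiableAt_stripProduct x k (hD z hz)).differentiableWithinAt,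
    fun z hz ↦ ?_, fun j l hl ↦ ?_⟩, fun t _ ↦ ?_⟩, fun t _ ↦ ?_⟩
  · rw [stripProduct, norm_prod]
    -- The empty product is 1, so strictness requires a node.
    refine Finset.prod_induction_nonempty _ (fun r : ℝ ↦ 0 ≤ r ∧ r < 1) ?_ ⟨⟨0, hn⟩, by simp⟩ ?_
      |>.2
    · rintro p q ⟨hp0, hp1⟩ ⟨hq0, hq1⟩
      exact ⟨mul_nonneg hp0 hq0, mul_lt_one_of_nonneg_of_lt_one_left hp0 hp1 hq1.le⟩
    · intro j _
      rw [norm_pow]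
      exact ⟨by positivity, pow_lt_one₀ (norm_nonneg _) (norm_stripMap_lt_one _ (hD z hz))
        (by have := hk j; omega)⟩
  · have hj : |((x j : ℝ) : ℂ).im| < d := by simpa using hd
    have heq : stripProduct d x k = fun w ↦ stripMap d (x j) w ^ (2 * k j) *
        ∏ i ∈ Finset.univ.erase j, stripMap d (x i) w ^ (2 * k i) := by
      funext w
      exact (Finset.mul_prod_erase _ _ (Finset.mem_univ j)).symm
    rw [heq]
    refine iteratedDeriv_pow_mul_eq_zero
      (analyticAt_of_strip (fun z hz ↦ differentiableAt_stripMap (x j) hz) hj)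
      (analyticAt_of_strip (fun z hz ↦ ?_) hj) (stripMap_self d (x j)) (by omega)
    exact DifferentiableAt.fun_finsetProd fun i _ ↦ (differentiableAt_stripMap (x i) hz).pow _
  · rw [stripProduct_ofReal, Complex.ofReal_im]
  · rw [stripProduct_ofReal, Complex.ofReal_re]
    positivity

theorem exp_sum_potential_le (hd : 0 < d) {t : ℝ} (ht : ∀ j, t ≠ x j) :
    Real.exp (∑ j, (2 * k j : ℕ) * potential (2 * d) (x j) t) ≤ ‖stripProduct d x k t‖ := by
  rw [Real.exp_sum, stripProduct, norm_prod]
  refine Finset.prod_le_prod (fun j _ ↦ (Real.exp_pos _).le) fun j _ ↦ ?_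
  rw [Real.exp_nat_mul, norm_pow, exp_potential (by positivity) (ht j)]
  exact pow_le_pow_left₀ (by positivity) (le_abs_stripMap_ofReal hd _ _) _

theorem le_norm_integral_stripProduct (hd : 0 < d) (hx : ∀ j, x j ∈ Icc (-1 : ℝ) 1) :
    2 * Real.exp (-(2 * (∑ j, k j : ℕ)) *
      ((1 + 2 * d) * Real.log (1 + 2 * d) - 2 * d * Real.log (2 * d))) ≤
      ‖∫ t in Icc (-1 : ℝ) 1, stripProduct d x k (t : ℂ)‖ := by
  have hreal : ∀ t : ℝ, stripProduct d x k t = ((‖stripProduct d x k t‖ : ℝ) : ℂ) := fun t ↦ by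
    rw [stripProduct_ofReal, Complex.norm_real, Real.norm_of_nonneg (by positivity)]
  have hcont : Continuous fun t : ℝ ↦ ‖stripProduct d x k t‖ := by
    refine (continuous_iff_continuousAt.2 fun t ↦ ?_).norm
    exact ContinuousAt.comp (f := fun t : ℝ ↦ (t : ℂ))
      (differentiableAt_stripProduct x k (by simpa using hd)).continuousAt
      Complex.continuous_ofReal.continuousAt
  have hint : ∫ t in Icc (-1 : ℝ) 1, stripProduct d x k (t : ℂ) =
      ((∫ t in (-1 : ℝ)..1, ‖stripProduct d x k t‖ : ℝ) : ℂ) := by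
    rw [integral_Icc_eq_integral_Ioc, ← intervalIntegral.integral_of_le (by norm_num),
      ← intervalIntegral.integral_ofReal]
    exact intervalIntegral.integral_congr fun t _ ↦ hreal t
  rw [hint, Complex.norm_real]
  refine le_trans ?_ (Real.le_norm_self _)
  have hpot : ∀ j ∈ Finset.univ, IntervalIntegrable
      (fun t ↦ ((2 * k j : ℕ) : ℝ) * potential (2 * d) (x j) t) volume (-1) 1 := fun j _ ↦
    (intervalIntegrable_potential (by positivity) _ _ _).const_mul _
  refine two_mul_exp_le_integral
    (h := fun t ↦ ∑ j, ((2 * k j : ℕ) : ℝ) * potential (2 * d) (x j) t)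
    (hcont.intervalIntegrable _ _) ?_ ?_ ?_
  · simpa only [Finset.sum_fn] using IntervalIntegrable.sum Finset.univ hpot
  · rw [intervalIntegral.integral_finsetSum hpot]
    have : ∀ j ∈ Finset.univ, ((2 * k j : ℕ) : ℝ) *
        (-2 * ((1 + 2 * d) * Real.log (1 + 2 * d) - 2 * d * Real.log (2 * d))) ≤
        ∫ t in (-1 : ℝ)..1, ((2 * k j : ℕ) : ℝ) * potential (2 * d) (x j) t := fun j _ ↦ by
      rw [intervalIntegral.integral_const_mul]
      exact mul_le_mul_of_nonneg_left (le_integral_potential (by positivity) (hx j))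
        (Nat.cast_nonneg _)
    refine le_trans (le_of_eq ?_) (Finset.sum_le_sum this)
    rw [← Finset.sum_mul]
    push_cast
    rw [← Finset.mul_sum]
    ring
  -- At a node `Real.log 0 = 0` makes the potential finite although the product may vanish, so nodes
  -- are discarded as a null set.
  · have h0 : ∀ᵐ t : ℝ, t ∉ Set.range x := (Set.finite_range x).measure_zero volume |>
      measure_eq_zero_iff_ae_notMem.1
    filter_upwards [h0] with t ht _
    exact exp_sum_potential_le x k hd fun j hj ↦ ht ⟨j, hj.symm⟩

end stripProduct

/-! ### Lower bound for domains inside a strip -/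

theorem bddAbove_norm_integral {D : Set ℂ} (hD : ∀ t ∈ Icc (-1 : ℝ) 1, (t : ℂ) ∈ D) {n : ℕ}
    (x : Fin n → ℝ) (k : Fin n → ℕ) :
    BddAbove {r : ℝ | ∃ f ∈ admissibleNonneg D x k,
      r = ‖∫ t in Icc (-1 : ℝ) 1, f (t : ℂ)‖} := by
  refine ⟨1 * volume.real (Icc (-1 : ℝ) 1), ?_⟩
  rintro _ ⟨f, hf, rfl⟩
  exact norm_setIntegral_le_of_norm_le_const (by simp) fun t ht ↦ (hf.1.1.2.1 _ (hD t ht)).le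

theorem le_JPlus_of_strip {D : Set ℂ} {d : ℝ} (hd : 0 < d) (hD : ∀ z ∈ D, |z.im| < d)
    (hI : ∀ t ∈ Icc (-1 : ℝ) 1, (t : ℂ) ∈ D) {N : ℕ} (hN : 0 < N) :
    2 * Real.exp (-(2 * N) *
      ((1 + 2 * d) * Real.log (1 + 2 * d) - 2 * d * Real.log (2 * d))) ≤
      JPlus D volume N := by
  -- A single node 0 of multiplicity N shows that the infimum is over a nonempty set.
  refine le_csInf ⟨_, 1, fun _ ↦ 0, fun _ ↦ N, Subsingleton.strictMono _, fun _ ↦ by simp,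
    fun _ ↦ hN, by simp, rfl⟩ ?_
  rintro _ ⟨n, x, k, -, hx, hk, rfl, rfl⟩
  have hn : 0 < n := by
    rcases Nat.eq_zero_or_pos n with rfl | h
    · simp at hN
    · exact h
  exact (le_norm_integral_stripProduct x k hd hx).trans (le_csSup (bddAbove_norm_integral hI x k)
    ⟨_, stripProduct_mem_admissibleNonneg x k hd hD hk hn, rfl⟩)

/-! ### Geometry of the ellipse -/

theorem boundaryDist_le {D : Set ℂ} {x z : ℂ} (hz : z ∉ D) : boundaryDist D x ≤ ‖x - z‖ :=
  csInf_le ⟨0, by rintro _ ⟨w, -, rfl⟩; positivity⟩ ⟨z, hz, rfl⟩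

theorem inradius_ellipseInterior {a b : ℝ} (ha : 1 ≤ a) (hb : 0 < b) (hab : b ≤ a) :
    inradius (ellipseInterior a b) = b := by
  have ha0 : 0 < a := by linarith
  have hle : ∀ x ∈ Icc (-1 : ℝ) 1, boundaryDist (ellipseInterior a b) x ≤ b := by
    intro x hx
    have hx1 : x ^ 2 / a ^ 2 ≤ 1 := by
      rw [div_le_one (by positivity)]
      nlinarith [hx.1, hx.2]
    -- The boundary point vertically above x.
    have hnot : (⟨x, b * √(1 - x ^ 2 / a ^ 2)⟩ : ℂ) ∉ ellipseInterior a b := by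
      simp only [ellipseInterior, mem_ofPred_eq, not_lt]
      rw [mul_pow, Real.sq_sqrt (by linarith), mul_div_cancel_left₀ _ (by positivity)]
      linarith
    refine (boundaryDist_le hnot).trans ?_
    have heq : (x : ℂ) - ⟨x, b * √(1 - x ^ 2 / a ^ 2)⟩ =
        ((-(b * √(1 - x ^ 2 / a ^ 2)) : ℝ) : ℂ) * Complex.I := by
      apply Complex.ext <;> simp
    rw [heq, norm_mul, Complex.norm_I, mul_one, Complex.norm_real, norm_neg,
      Real.norm_of_nonneg (by positivity)]
    refine mul_le_of_le_one_right hb.le (Real.sqrt_le_one.2 ?_)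
    have : 0 ≤ x ^ 2 / a ^ 2 := by positivity
    linarith
  -- As b ≤ a, the disc of radius b about 0 lies in the ellipse.
  have hge : b ≤ boundaryDist (ellipseInterior a b) ((0 : ℝ) : ℂ) := by
    refine le_csInf ⟨_, (a : ℂ), ?_, rfl⟩ ?_
    · simp [ellipseInterior, ha0.ne']
    · rintro _ ⟨z, hz, rfl⟩
      simp only [ellipseInterior, mem_ofPred_eq, not_lt] at hz
      rw [Complex.ofReal_zero, zero_sub, norm_neg, ← abs_of_pos hb, ← abs_norm, ← sq_le_sq,
        ← Complex.normSq_eq_norm_sq, Complex.normSq_apply]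
      have h1 : z.re ^ 2 / a ^ 2 ≤ z.re ^ 2 / b ^ 2 := by gcongr
      have h2 : 1 ≤ (z.re ^ 2 + z.im ^ 2) / b ^ 2 := by
        rw [add_div]
        linarith
      rw [le_div_iff₀ (by positivity)] at h2
      linarith
  apply le_antisymm
  · refine csSup_le ⟨_, 0, by simp, rfl⟩ ?_
    rintro _ ⟨x, hx, rfl⟩
    exact hle x hx
  · refine hge.trans (le_csSup ⟨b, ?_⟩ ⟨0, by simp, rfl⟩)
    rintro _ ⟨x, hx, rfl⟩
    exact hle x hx

theorem abs_im_lt_of_mem_ellipseInterior {a b : ℝ} (hb : 0 < b) {z : ℂ}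
    (hz : z ∈ ellipseInterior a b) : |z.im| < b := by
  simp only [ellipseInterior, mem_ofPred_eq] at hz
  have h0 : 0 ≤ z.re ^ 2 / a ^ 2 := by positivity
  have h1 : z.im ^ 2 / b ^ 2 < 1 := by linarith
  rw [div_lt_one (by positivity)] at h1
  exact abs_lt_of_sq_lt_sq h1 hb.le

theorem ofReal_mem_ellipseInterior {a : ℝ} (b : ℝ) (ha : 1 < a) {t : ℝ}
    (ht : t ∈ Icc (-1 : ℝ) 1) : (t : ℂ) ∈ ellipseInterior a b := by
  simp only [ellipseInterior, mem_ofPred_eq, Complex.ofReal_re, Complex.ofReal_im]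
  rw [zero_pow two_ne_zero, zero_div, add_zero, div_lt_one (by positivity)]
  nlinarith [ht.1, ht.2]

end EllipseQuadrature

open EllipseQuadrature in
theorem mainTheorem7 (c : ℝ) (hc : 1 < c) :
    EllipseQuadrature.inradius (EllipseQuadrature.ellipse c) = (c ^ 2 - 1) / (2 * c) ∧
    ∀ N : ℕ, 0 < N →
      2 * (((c ^ 2 - 1 + c) / (c ^ 2 - 1)) ^ ((c ^ 2 - 1) / c) *
          ((c ^ 2 - 1 + c) / c)) ^ (-(2 * (N : ℤ))) ≤
        EllipseQuadrature.JPlus (EllipseQuadrature.ellipse c) (volume : Measure ℝ) N := by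
  have hc0 : 0 < c := by linarith
  have hc2 : 0 < c ^ 2 - 1 := by nlinarith
  obtain ⟨-, hb, hab, -⟩ := (semiAxes_iff hc _ _).2 ⟨rfl, rfl⟩
  have ha : 1 < semiMajor c := by
    rw [semiMajor, lt_div_iff₀ (by positivity)]
    nlinarith [sq_pos_of_pos (sub_pos.2 hc)]
  refine ⟨inradius_ellipseInterior ha.le hb (by nlinarith), fun N hN ↦ ?_⟩
  refine le_trans (le_of_eq ?_) (le_JPlus_of_strip hb
    (fun z hz ↦ abs_im_lt_of_mem_ellipseInterior hb hz)
    (fun t ht ↦ ofReal_mem_ellipseInterior _ ha ht) hN)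
  have hs : 2 * semiMinor c = (c ^ 2 - 1) / c := by
    rw [semiMinor]
    field_simp
  rw [hs]
  have hs0 : 0 < (c ^ 2 - 1) / c := by positivity
  have h1 : (c ^ 2 - 1 + c) / c = 1 + (c ^ 2 - 1) / c := by
    field_simp
    ring
  have h2 : (c ^ 2 - 1 + c) / (c ^ 2 - 1) = (1 + (c ^ 2 - 1) / c) / ((c ^ 2 - 1) / c) := by
    field_simp
    ring
  rw [h1, h2]
  generalize (c ^ 2 - 1) / c = s at hs0
  have hM : ((1 + s) / s) ^ s * (1 + s) =
      Real.exp ((1 + s) * Real.log (1 + s) - s * Real.log s) := by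
    rw [Real.rpow_def_of_pos (by positivity), Real.log_div (by positivity) hs0.ne']
    have h3 : (1 + s) * Real.log (1 + s) - s * Real.log s =
        (Real.log (1 + s) - Real.log s) * s + Real.log (1 + s) := by
      ring
    rw [h3, Real.exp_add, Real.exp_log (by positivity : 0 < 1 + s)]
  rw [hM, ← Real.rpow_intCast, ← Real.exp_mul]
  push_cast
  rw [mul_comm (-(2 * (N : ℝ)))]
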